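/- Let $n \ge 0$ be an integer, let $\mathrm{SU}(n)$ act on $\Lambda^2(\mathbb{C}^n)$ through its defining representation on $\mathbb{C}^n$ (the two-index antisymmetric representation, the state space of one quark $Q^{[\alpha\beta]}$), and put $N = n(n-1)/2$. A gauge wave function of $k$ quarks is an element $\psi$ of the tensor power $(\Lambda^2\mathbb{C}^n)^{\otimes k}$. It is a gauge singlet if it is fixed by the diagonal action of every $g \in \mathrm{SU}(n)$, and it is completely antisymmetric if the exchange of any two distinct tensor factors sends $\psi$ to $-\psi$. Then: 1. If $k > 0$ and there is a nonzero completely antisymmetric gauge singlet of $k$ quarks, then $k = N$. 2. For $k = N$ the completely antisymmetric gauge singlets form a one-dimensional complex vector space; so such a nonzero wave function exists and is unique up to a scalar factor. 3. For $k = N$ this one-dimensional space is the whole completely antisymmetric subspace of the tensor product $(\Lambda^2\mathbb{C}^n)^{\otimes N}$. 4. Equivalently, in terms of exterior powers: if $k > 0$ and $\Lambda^k(\Lambda^2\mathbb{C}^n)$ has a nonzero $\mathrm{SU}(n)$-invariant vector, then $k = N$; and the space of $\mathrm{SU}(n)$-invariants in $\Lambda^{N}(\Lambda^2\mathbb{C}^n)$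 is one-dimensional. -/

import Mathlib

open scoped TensorProduct

noncomputable section

/-- The gauge group `SU(n)`. -/
abbrev GaugeGroup (n : ℕ) : Type :=
  Matrix.specialUnitaryGroup (Fin n) ℂ

/-- The defining representation of `SU(n)` on `ℂⁿ`. -/
def fundamentalRep (n : ℕ) : Representation ℂ (GaugeGroup n) (Fin n → ℂ) where
  toFun g := Matrix.mulVecLin (g : Matrix (Fin n) (Fin n) ℂ)
  map_one' := by
    rw [OneMemClass.coe_one, Matrix.mulVecLin_one]
    rfl
  map_mul' g h := by
    rw [Submonoid.coe_mul, Matrix.mulVecLin_mul]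
    rfl

/-- The `k`-th exterior power of a representation, with
`g • (v₁ ∧ ⋯ ∧ vₖ) = g v₁ ∧ ⋯ ∧ g vₖ`. -/
def exteriorPowerRep {G V : Type} [Group G] [AddCommGroup V] [Module ℂ V]
    (ρ : Representation ℂ G V) (k : ℕ) : Representation ℂ G (⋀[ℂ]^k V) where
  toFun g := exteriorPower.map k (ρ g)
  map_one' := by
    rw [map_one]
    exact exteriorPower.map_id
  map_mul' g h := by
    rw [map_mul]
    exact exteriorPower.map_comp (ρ h) (ρ g)

/-- The space `Λ²(ℂⁿ)` of a quark with two antisymmetric gauge indices. -/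
abbrev Quark (n : ℕ) : Type :=
  ⋀[ℂ]^2 (Fin n → ℂ)

/-- The two-index antisymmetric representation of `SU(n)`. -/
def quarkRep (n : ℕ) : Representation ℂ (GaugeGroup n) (Quark n) :=
  exteriorPowerRep (fundamentalRep n) 2

/-- The gauge wave functions of `k` quarks, each with state space `V`: the tensor
power `V^{⊗ k}`. -/
abbrev WaveFunction (V : Type) [AddCommGroup V] [Module ℂ V] (k : ℕ) : Type :=
  ⨂[ℂ] _i : Fin k, V

/-- The `k`-th tensor power of a representation, with
`g • (v₁ ⊗ ⋯ ⊗ vₖ) = g v₁ ⊗ ⋯ ⊗ g vₖ`. -/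
def tensorPowerRep {G V : Type} [Group G] [AddCommGroup V] [Module ℂ V]
    (ρ : Representation ℂ G V) (k : ℕ) : Representation ℂ G (WaveFunction V k) where
  toFun g := PiTensorProduct.map fun _ => ρ g
  map_one' := by
    simp only [map_one, PiTensorProduct.map_one]
  map_mul' g h := by
    simp only [map_mul, PiTensorProduct.map_mul]

/-- The operator on `V^{⊗ k}` which exchanges the quarks (tensor factors) `i` and `j`. -/
def exchange (V : Type) [AddCommGroup V] [Module ℂ V] {k : ℕ} (i j : Fin k) :
    WaveFunction V k →ₗ[ℂ] WaveFunction V k :=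
  (PiTensorProduct.reindex ℂ (fun _ : Fin k => V) (Equiv.swap i j)).toLinearMap

/-- The gauge singlets among the wave functions of `k` quarks: the elements of `V^{⊗ k}`
fixed by the whole group. -/
def singlets {G V : Type} [Group G] [AddCommGroup V] [Module ℂ V]
    (ρ : Representation ℂ G V) (k : ℕ) : Submodule ℂ (WaveFunction V k) :=
  (tensorPowerRep ρ k).invariants

/-- The completely antisymmetric subspace of `V^{⊗ k}`: the wave functions which change sign
under the exchange of any two distinct quarks. -/
def antisymmetric (V : Type) [AddCommGroup V] [Module ℂ V] (k : ℕ) :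
    Submodule ℂ (WaveFunction V k) where
  carrier := {ψ | ∀ i j : Fin k, i ≠ j → exchange V i j ψ = -ψ}
  zero_mem' i j _ := by simp
  add_mem' {ψ φ} hψ hφ i j hij := by
    rw [map_add, hψ i j hij, hφ i j hij, neg_add]
  smul_mem' c ψ hψ i j hij := by
    rw [map_smul, hψ i j hij, smul_neg]

/-- The gauge singlets that are completely antisymmetric under the exchange of quarks. -/
def antisymmetricSinglets {G V : Type} [Group G] [AddCommGroup V] [Module ℂ V]
    (ρ : Representation ℂ G V) (k : ℕ) : Submodule ℂ (WaveFunction V k) :=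
  singlets ρ k ⊓ antisymmetric V k

end

/-!
The number of quarks is determined by the second order Casimir operator `∑ E_ab E_ba` of `gl(n)`.
Acting on a tensor with `2k` indices it is `2kn` plus the sum of all transpositions of two distinct
indices (`casimir_eq`), because `∑ E_ab ⊗ E_ba` is the flip. On the `k`-th exterior power of `Λ²`
this sum is a scalar (`sum_comp_swap_eq`): exchanging the two indices of one quark gives `-1`, and
the four exchanges of an index of one quark with an index of another one cancel in pairs. The
Casimir operator is therefore multiplication by `2k(n-1)`. On a gauge singlet, on the other hand,
`E_ab` acts as zero for `a ≠ b`, and all `E_aa` act as the scalar `2k/n` (`derivAct_single_eq`):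
differentiating along `SU(n)` shows that all rank one orthogonal projections act in the same way,
and these span the matrices. Hence `(2k)²/n = 2k(n-1)`, that is, `2k = n(n-1)`
(`eq_of_invariant_tensor`). To run this computation a wave function is replaced by its components
with respect to the `2k` gauge indices, which determine it (`eq_zero_of_component_eq_zero`).

For `k = n(n-1)/2 = dim Λ²(ℂⁿ)` antisymmetrization identifies the completely antisymmetric wave
functions with the top exterior power of `Λ²(ℂⁿ)` (`range_toTensorPower`), which is a line. The
group acts on it by the determinant of its action on `Λ²(ℂⁿ)`, and that determinant is `1` for every
matrix of determinant `1` (`detSquare_eq_one`): such a matrix is a product of transvections, on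
which a character is trivial, and of a diagonal matrix of determinant `1`, for which the determinant
on `Λ²(ℂⁿ)` is the power `n - 1` of the original one. So the whole line consists of singlets.
-/

/-! ### Tensors in coordinates -/

/-- The action of a matrix on a tensor with components `ψ f`, where `f` assigns an index to each
slot in `S`: the matrix acts in every slot at once. -/
def tensorAct {ι S : Type*} [Fintype ι] [Fintype S] [DecidableEq S] (M : Matrix ι ι ℂ)
    (ψ : (S → ι) → ℂ) (f : S → ι) : ℂ :=
  ∑ h : S → ι, (∏ s, M (f s) (h s)) * ψ h

/-- The infinitesimal version of `tensorAct`: the sum over the slots of the action of the matrix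
in that slot alone. -/
def derivAct {ι S : Type*} [Fintype ι] [Fintype S] [DecidableEq S] (A : Matrix ι ι ℂ)
    (ψ : (S → ι) → ℂ) (f : S → ι) : ℂ :=
  ∑ s, ∑ c, A (f s) c * ψ (Function.update f s c)

section Tensors

variable {ι S : Type*} [Fintype ι] [DecidableEq ι] [Fintype S] [DecidableEq S]

omit [DecidableEq ι] in
lemma derivAct_add (A B : Matrix ι ι ℂ) (ψ : (S → ι) → ℂ) (f : S → ι) :
    derivAct (A + B) ψ f = derivAct A ψ f + derivAct B ψ f := by
  simp only [derivAct, Matrix.add_apply, add_mul, Finset.sum_add_distrib]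

omit [DecidableEq ι] in
lemma derivAct_smul (c : ℂ) (A : Matrix ι ι ℂ) (ψ : (S → ι) → ℂ) (f : S → ι) :
    derivAct (c • A) ψ f = c * derivAct A ψ f := by
  simp only [derivAct, Matrix.smul_apply, smul_eq_mul, mul_assoc, Finset.mul_sum]

lemma derivAct_single (a b : ι) (ψ : (S → ι) → ℂ) (f : S → ι) :
    derivAct (Matrix.single a b 1) ψ f =
      ∑ s, if f s = a then ψ (Function.update f s b) else 0 := by
  refine Finset.sum_congr rfl fun s _ => ?_
  by_cases h : f s = a
  · rw [Finset.sum_eq_single b]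
    · simp [h]
    · intro c _ hc
      simp [hc.symm]
    · simp
  · simp [h, Ne.symm h]

lemma sum_derivAct_single_self (ψ : (S → ι) → ℂ) (f : S → ι) :
    ∑ a, derivAct (Matrix.single a a 1) ψ f = Fintype.card S * ψ f := by
  simp_rw [derivAct_single]
  rw [Finset.sum_comm]
  simp

lemma hasDerivAt_tensorAct {M : ℝ → Matrix ι ι ℂ} {A : Matrix ι ι ℂ} (h0 : M 0 = 1)
    (hM : ∀ a b, HasDerivAt (fun t => M t a b) (A a b) 0) (ψ : (S → ι) → ℂ) (f : S → ι) :
    HasDerivAt (fun t => tensorAct (M t) ψ f) (derivAct A ψ f) 0 := by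
  have key : HasDerivAt (fun t => tensorAct (M t) ψ f)
      (∑ h : S → ι, (∑ s, (∏ r ∈ Finset.univ.erase s, M 0 (f r) (h r)) • A (f s) (h s)) * ψ h)
      0 := by
    refine HasDerivAt.fun_sum fun h _ => HasDerivAt.mul_const ?_ _
    have := HasDerivAt.finsetProd (u := Finset.univ)
      (f := fun (s : S) (t : ℝ) => M t (f s) (h s)) (f' := fun s => A (f s) (h s))
      (x := (0 : ℝ)) (fun s _ => hM _ _)
    convert this using 1
    ext t
    simp
  convert key using 1
  simp only [derivAct, Finset.sum_mul]
  rw [Finset.sum_comm (s := (Finset.univ : Finset (S → ι)))]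
  refine Finset.sum_congr rfl fun s _ => ?_
  refine Finset.sum_of_injOn (fun c => Function.update f s c) ?_ (by simp) ?_ ?_
  · intro c _ d _ hcd
    simpa using congrFun hcd s
  -- the Kronecker deltas leave only the index assignments which differ from `f` at most in `s`
  · intro h _ hh
    have hex : ∃ r, r ≠ s ∧ f r ≠ h r := by
      by_contra! hcon
      refine hh ⟨h s, by simp, ?_⟩
      ext r
      by_cases hr : r = s
      · subst hr; simp
      · simp [hr, hcon r hr]
    obtain ⟨r, hr, hfr⟩ := hex
    rw [Finset.prod_eq_zero (i := r) (by simp [hr]) (by rw [h0, Matrix.one_apply_ne hfr])]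
    simp
  · intro c _
    rw [Finset.prod_eq_one]
    · simp
    · intro r hr
      rw [Function.update_of_ne (Finset.ne_of_mem_erase hr), h0, Matrix.one_apply_eq]

/-- The second order Casimir operator acts on tensors through the transpositions of the slots,
because the contraction `∑ E_ab ⊗ E_ba` is the flip of `V ⊗ V`. -/
lemma casimir_eq (ψ : (S → ι) → ℂ) (f : S → ι) :
    ∑ a, ∑ b, derivAct (Matrix.single a b 1)
        (fun h => derivAct (Matrix.single b a 1) ψ h) f =
      Fintype.card S * Fintype.card ι * ψ f +
        ∑ s, ∑ t ∈ Finset.univ.erase s, ψ (f ∘ Equiv.swap s t) := by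
  have h1 : ∑ a, ∑ b, derivAct (Matrix.single a b 1)
        (fun h => derivAct (Matrix.single b a 1) ψ h) f =
      ∑ s, ∑ b, ∑ t, if Function.update f s b t = b then
        ψ (Function.update (Function.update f s b) t (f s)) else 0 := by
    simp_rw [derivAct_single]
    rw [Finset.sum_comm]
    calc _ = ∑ b, ∑ s, ∑ a, if f s = a then
          ∑ t, (if Function.update f s b t = b then
            ψ (Function.update (Function.update f s b) t a) else 0) else 0 :=
          Finset.sum_congr rfl fun b _ => Finset.sum_comm
      _ = _ := by
          simp only [Finset.sum_ite_eq, Finset.mem_univ, if_true]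
          rw [Finset.sum_comm]
  rw [h1, mul_assoc, ← Finset.card_univ (α := S), ← nsmul_eq_mul, ← Finset.sum_const,
    ← Finset.sum_add_distrib]
  refine Finset.sum_congr rfl fun s _ => ?_
  rw [Finset.sum_comm, ← Finset.add_sum_erase _ _ (Finset.mem_univ s)]
  congr 1
  · simp
  · refine Finset.sum_congr rfl fun t ht => ?_
    have hts := Finset.ne_of_mem_erase ht
    simp only [Function.update_of_ne hts, Finset.sum_ite_eq, Finset.mem_univ, if_true]
    congr 1
    ext r
    rcases eq_or_ne r t with rfl | hrt
    · simp
    · rcases eq_or_ne r s with rfl | hrs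
      · simp [hrt]
      · simp [hrt, hrs, Equiv.swap_apply_of_ne_of_ne]

end Tensors

/-! ### Infinitesimal invariance under `SU(n)` -/

section Infinitesimal

open Matrix

variable {n : ℕ}

lemma one_add_smul_mul_one_add_smul {P : Matrix (Fin n) (Fin n) ℂ} (hP : P * P = P) (c d : ℂ) :
    (1 + c • P) * (1 + d • P) = 1 + (c + d + c * d) • P := by
  simp only [add_mul, mul_add, one_mul, mul_one, smul_mul_assoc, mul_smul_comm, hP]
  module

/-- The complex reflection with factor `e ^ (I t)` along a unit vector is unitary. -/
lemma reflection_mem_unitary {P : Matrix (Fin n) (Fin n) ℂ} (hP : P * P = P) (hPh : Pᴴ = P)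
    (t : ℝ) : 1 + (Complex.exp (t * Complex.I) - 1) • P ∈ unitaryGroup (Fin n) ℂ := by
  rw [mem_unitaryGroup_iff, star_eq_conjTranspose]
  have hc : star (Complex.exp (t * Complex.I)) = Complex.exp (-(t * Complex.I)) := by
    rw [Complex.star_def, ← Complex.exp_conj]
    simp
  have he : Complex.exp (t * Complex.I) * Complex.exp (-(t * Complex.I)) = 1 := by
    rw [← Complex.exp_add]; simp
  simp only [conjTranspose_add, conjTranspose_one, conjTranspose_smul, hPh, star_sub, star_one,
    hc]
  rw [one_add_smul_mul_one_add_smul hP]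
  have : Complex.exp (t * Complex.I) - 1 + (Complex.exp (-(t * Complex.I)) - 1) +
      (Complex.exp (t * Complex.I) - 1) * (Complex.exp (-(t * Complex.I)) - 1) = 0 := by
    linear_combination he
  rw [this]; simp

lemma det_one_add_smul_vecMulVec (v w : Fin n → ℂ) (c : ℂ) (h : w ⬝ᵥ v = 1) :
    (1 + c • vecMulVec v w).det = 1 + c := by
  have := det_one_add_replicateCol_mul_replicateRow (ι := Unit) (c • v) w
  rw [← vecMulVec_eq, smul_vecMulVec] at this
  rw [this, dotProduct_smul, h]; simp

/-- A tensor which is fixed by `SU(n)` is acted on in the same way by all rank one orthogonal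
projections: rotating the phases along the two lines in opposite directions is a one-parameter
subgroup of `SU(n)`. -/
lemma derivAct_projection_eq {S : Type*} [Fintype S] [DecidableEq S] {ψ : (S → Fin n) → ℂ}
    (hψ : ∀ (g : GaugeGroup n) (f : S → Fin n),
      tensorAct (g : Matrix (Fin n) (Fin n) ℂ) ψ f = ψ f)
    {v w x y : Fin n → ℂ} (hv : w ⬝ᵥ v = 1) (hx : y ⬝ᵥ x = 1)
    (hvh : (vecMulVec v w)ᴴ = vecMulVec v w) (hxh : (vecMulVec x y)ᴴ = vecMulVec x y)
    (f : S → Fin n) :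
    derivAct (vecMulVec v w) ψ f = derivAct (vecMulVec x y) ψ f := by
  set P := vecMulVec v w with hPdef
  set Q := vecMulVec x y with hQdef
  have hP : P * P = P := by rw [hPdef, vecMulVec_mul_vecMulVec, hv, one_smul]
  have hQ : Q * Q = Q := by rw [hQdef, vecMulVec_mul_vecMulVec, hx, one_smul]
  let u : ℝ → ℂ := fun t => Complex.exp (t * Complex.I) - 1
  let u' : ℝ → ℂ := fun t => Complex.exp ((-t : ℝ) * Complex.I) - 1
  let M : ℝ → Matrix (Fin n) (Fin n) ℂ := fun t => (1 + u t • P) * (1 + u' t • Q)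
  have hmem (t : ℝ) : M t ∈ specialUnitaryGroup (Fin n) ℂ := by
    rw [mem_specialUnitaryGroup_iff]
    refine ⟨mul_mem (reflection_mem_unitary hP hvh t) (reflection_mem_unitary hQ hxh (-t)), ?_⟩
    rw [det_mul, det_one_add_smul_vecMulVec _ _ _ hv, det_one_add_smul_vecMulVec _ _ _ hx,
      add_sub_cancel, add_sub_cancel, ← Complex.exp_add]
    simp
  have hu : HasDerivAt u Complex.I 0 := by
    have h1 : HasDerivAt (fun t : ℝ => (t : ℂ) * Complex.I) (1 * Complex.I) 0 :=
      (Complex.ofRealCLM.hasDerivAt (x := (0 : ℝ))).mul_const _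
    have h2 := h1.cexp.sub_const 1
    simp only [Complex.ofReal_zero, zero_mul, Complex.exp_zero, one_mul] at h2
    exact h2
  have hu' : HasDerivAt u' (-Complex.I) 0 := by
    have h1 : HasDerivAt u Complex.I (-0) := by simpa using hu
    have := h1.scomp (0 : ℝ) (hasDerivAt_neg (0 : ℝ))
    simpa [u, u', Function.comp_def] using this
  have hu0 : u 0 = 0 := by simp [u]
  have hu0' : u' 0 = 0 := by simp [u']
  have hM : ∀ a b, HasDerivAt (fun t => M t a b)
      ((Complex.I • (P + (-1 : ℂ) • Q)) a b) 0 := by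
    intro a b
    have hexp : (fun t => M t a b) = fun t =>
        (1 : Matrix (Fin n) (Fin n) ℂ) a b + u t * P a b + u' t * Q a b +
          u t * u' t * (P * Q) a b := by
      ext t
      simp only [M, add_mul, mul_add, one_mul, mul_one, smul_mul_assoc, mul_smul_comm,
        Matrix.add_apply, Matrix.smul_apply, smul_eq_mul]
      ring
    rw [hexp]
    have := (((hu.mul_const (P a b)).const_add ((1 : Matrix (Fin n) (Fin n) ℂ) a b)).add
      (hu'.mul_const (Q a b))).add ((hu.mul hu').mul_const ((P * Q) a b))
    refine this.congr_deriv ?_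
    simp only [hu0, hu0', Matrix.smul_apply, Matrix.add_apply, smul_eq_mul]
    ring
  have hM0 : M 0 = 1 := by simp [M, hu0, hu0']
  have hd := hasDerivAt_tensorAct hM0 hM ψ f
  have hconst : (fun t => tensorAct (M t) ψ f) = fun _ => ψ f :=
    funext fun t => hψ ⟨M t, hmem t⟩ f
  rw [hconst] at hd
  have h0 := hd.unique (hasDerivAt_const (0 : ℝ) (ψ f))
  rw [derivAct_smul, derivAct_add, derivAct_smul] at h0
  have := (mul_eq_zero.mp h0).resolve_left Complex.I_ne_zero
  linear_combination this

/-- By polarisation, on a tensor fixed by `SU(n)` the matrix unit `E_ab` acts as zero for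
`a ≠ b`, and all `E_aa` act in the same way. -/
lemma derivAct_single_eq {S : Type*} [Fintype S] [DecidableEq S] {ψ : (S → Fin n) → ℂ}
    (hψ : ∀ (g : GaugeGroup n) (f : S → Fin n),
      tensorAct (g : Matrix (Fin n) (Fin n) ℂ) ψ f = ψ f) (a b : Fin n) (f : S → Fin n) :
    n * derivAct (single a b 1) ψ f = if a = b then Fintype.card S * ψ f else 0 := by
  have hproj : ∀ a : Fin n, vecMulVec (Pi.single a (1 : ℂ)) (Pi.single a (1 : ℂ)) =
      single a a (1 : ℂ) := fun a => by
    rw [single_eq_single_vecMulVec_single]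
  have hdiag : ∀ a c : Fin n,
      derivAct (single a a 1) ψ f = derivAct (single c c 1) ψ f := by
    intro a c
    rw [← hproj, ← hproj]
    apply derivAct_projection_eq hψ <;> simp [hproj, conjTranspose_single]
  split_ifs with hab
  · subst hab
    rw [← sum_derivAct_single_self, Finset.sum_congr rfl fun c _ => hdiag c a]
    simp
  · -- compare `E_aa` with the projections onto the lines of `e_a + z e_b`, for `z = 1` and `z = I`
    have hgen : ∀ z : ℂ, star z * z = 1 →
        star z * derivAct (single a b 1) ψ f + z * derivAct (single b a 1) ψ f = 0 := by
      intro z hz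
      let v : Fin n → ℂ := Pi.single a 1 + z • Pi.single b 1
      let w : Fin n → ℂ := (1 / 2 : ℂ) • (Pi.single a 1 + star z • Pi.single b 1)
      have hvw : vecMulVec v w = (1 / 2 : ℂ) • (single a a 1 + single b b 1 +
          (star z • single a b 1 + z • single b a 1)) := by
        simp only [v, w, vecMulVec_smul, add_vecMulVec, vecMulVec_add, smul_vecMulVec,
          ← single_eq_single_vecMulVec_single]
        congr 1
        rw [smul_add (star z), smul_smul (star z) z, hz, one_smul]
        abel
      have hherm : (vecMulVec v w)ᴴ = vecMulVec v w := by
        rw [hvw]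
        simp only [conjTranspose_smul, conjTranspose_add, conjTranspose_single, star_one,
          star_star]
        congr 1
        · simp
        · abel
      have hone : w ⬝ᵥ v = 1 := by
        have hz' : (starRingEnd ℂ) z * z = 1 := hz
        simp [v, w, hab, Ne.symm hab]
        linear_combination (1 / 2) * hz'
      have := derivAct_projection_eq hψ hone (x := Pi.single a 1) (y := Pi.single a 1)
        (by simp) hherm (by rw [hproj]; simp [conjTranspose_single]) f
      rw [hvw, hproj] at this
      simp only [derivAct_smul, derivAct_add] at this
      rw [hdiag b a] at this
      linear_combination 2 * this
    have h1 := hgen 1 (by simp)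
    have h2 := hgen Complex.I (by simp)
    simp only [star_one, one_mul, Complex.star_def, Complex.conj_I] at h1 h2
    have hI := Complex.I_mul_I
    have : derivAct (single a b 1) ψ f = 0 := by
      linear_combination (1 / 2) * h1 + (Complex.I / 2) * h2 +
        (1 / 2) * (derivAct (single a b 1) ψ f - derivAct (single b a 1) ψ f) * hI
    rw [this, mul_zero]

end Infinitesimal

/-! ### The number of quarks in a singlet -/

section Count

variable {n k : ℕ}

/-- On a tensor which is antisymmetric in the two indices of each quark and under the exchange of
quarks, the sum of the transpositions of two distinct slots is the scalar `-2k`: the four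
transpositions between the slots of two different quarks cancel in pairs. -/
lemma sum_comp_swap_eq {ι : Type*} {ψ : (Fin k × Fin 2 → ι) → ℂ}
    (hflip : ∀ (i : Fin k) f, ψ (f ∘ Equiv.swap (i, 0) (i, 1)) = -ψ f)
    (hexch : ∀ i j : Fin k, i ≠ j → ∀ f,
      ψ (f ∘ Prod.map (Equiv.swap i j) id) = -ψ f) (f : Fin k × Fin 2 → ι) :
    ∑ s, ∑ t ∈ Finset.univ.erase s, ψ (f ∘ Equiv.swap s t) = -(2 * k * ψ f) := by
  have hsame : ∀ i : Fin k, ∀ p q : Fin 2, p ≠ q →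
      ψ (f ∘ Equiv.swap (i, p) (i, q)) = -ψ f := by
    intro i p q hpq
    fin_cases p <;> fin_cases q <;> first | exact absurd rfl hpq | skip
    · exact hflip i f
    · rw [Equiv.swap_comm]; exact hflip i f
  have hpar : ∀ i j : Fin k, i ≠ j →
      ψ (f ∘ Equiv.swap (i, 1) (j, 1)) = -ψ (f ∘ Equiv.swap (i, 0) (j, 0)) := by
    intro i j hij
    rw [← hexch i j hij]
    congr 1
    ext ⟨r, p⟩
    simp only [Function.comp_apply, Prod.map_apply, id, Equiv.swap_apply_def]
    fin_cases p <;> simp <;> grind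
  have hcross : ∀ i j : Fin k, i ≠ j →
      ψ (f ∘ Equiv.swap (i, 1) (j, 0)) = -ψ (f ∘ Equiv.swap (i, 0) (j, 1)) := by
    intro i j hij
    have : f ∘ Equiv.swap (i, 1) (j, 0) = (((f ∘ Equiv.swap (i, 0) (j, 1)) ∘
        Equiv.swap (i, 0) (i, 1)) ∘ Equiv.swap (j, 0) (j, 1)) ∘
          Prod.map (Equiv.swap i j) id := by
      ext ⟨r, p⟩
      simp only [Function.comp_apply, Prod.map_apply, id, Equiv.swap_apply_def]
      fin_cases p <;> simp <;> grind
    rw [this, hexch i j hij, hflip, hflip, neg_neg]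
  have hpair : ∀ i j : Fin k, i ≠ j →
      ∑ p : Fin 2, ∑ q : Fin 2, ψ (f ∘ Equiv.swap (i, p) (j, q)) = 0 := by
    intro i j hij
    simp only [Fin.sum_univ_two, hpar i j hij, hcross i j hij]
    ring
  have hall : ∑ s, ∑ t, ψ (f ∘ Equiv.swap s t) = 0 := by
    simp only [Fintype.sum_prod_type]
    calc _ = ∑ i : Fin k, ∑ j : Fin k, ∑ p : Fin 2, ∑ q : Fin 2,
          ψ (f ∘ Equiv.swap (i, p) (j, q)) :=
          Finset.sum_congr rfl fun i _ => Finset.sum_comm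
      _ = 0 := by
        refine Finset.sum_eq_zero fun i _ => Finset.sum_eq_zero fun j _ => ?_
        rcases eq_or_ne i j with rfl | hij
        · simp [Fin.sum_univ_two, hsame]
        · exact hpair i j hij
  have hsplit : ∀ s : Fin k × Fin 2, ∑ t ∈ Finset.univ.erase s, ψ (f ∘ Equiv.swap s t) =
      (∑ t, ψ (f ∘ Equiv.swap s t)) - ψ f := by
    intro s
    rw [← Finset.add_sum_erase _ _ (Finset.mem_univ s)]
    simp
  simp only [hsplit, Finset.sum_sub_distrib, hall, Finset.sum_const, Finset.card_univ,
    Fintype.card_prod, Fintype.card_fin, nsmul_eq_mul]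
  push_cast
  ring

/-- The value of the Casimir operator on a tensor of the `k`-th exterior power of `Λ²` is
`2k(n-1)`; if the tensor is `SU(n)`-invariant, it is also `(2k)²/n`. -/
lemma eq_of_invariant_tensor (hk : 0 < k) {ψ : (Fin k × Fin 2 → Fin n) → ℂ}
    (hflip : ∀ (i : Fin k) f, ψ (f ∘ Equiv.swap (i, 0) (i, 1)) = -ψ f)
    (hexch : ∀ i j : Fin k, i ≠ j → ∀ f, ψ (f ∘ Prod.map (Equiv.swap i j) id) = -ψ f)
    (hinv : ∀ (g : GaugeGroup n) f, tensorAct (g : Matrix (Fin n) (Fin n) ℂ) ψ f = ψ f)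
    (hψ : ψ ≠ 0) : k = n * (n - 1) / 2 := by
  obtain ⟨f, hf⟩ := Function.ne_iff.mp hψ
  have hn : 0 < n := (f (⟨0, hk⟩, 0)).pos
  have hn' : (n : ℂ) ≠ 0 := by exact_mod_cast hn.ne'
  have hD : ∀ a b, (fun h => derivAct (Matrix.single a b 1) ψ h) =
      fun h => (if a = b then (2 * k / n : ℂ) else 0) * ψ h := by
    intro a b
    ext h
    apply mul_left_cancel₀ hn'
    rw [derivAct_single_eq hinv]
    split_ifs
    · simp only [Fintype.card_prod, Fintype.card_fin]
      push_cast
      field_simp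
    · simp
  have hmul : ∀ (c : ℂ) (A : Matrix (Fin n) (Fin n) ℂ) h,
      derivAct A (fun h => c * ψ h) h = c * derivAct A ψ h := by
    intro c A h
    simp only [derivAct, Finset.mul_sum]
    exact Finset.sum_congr rfl fun _ _ => Finset.sum_congr rfl fun _ _ => by ring
  have hcas := casimir_eq ψ f
  rw [sum_comp_swap_eq hflip hexch] at hcas
  have hlhs : ∑ a : Fin n, ∑ b : Fin n, derivAct (Matrix.single a b 1)
      (fun h => derivAct (Matrix.single b a 1) ψ h) f =
      ∑ a : Fin n, ∑ b : Fin n,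
        (if a = b then (2 * k / n : ℂ) * ((2 * k / n : ℂ) * ψ f) else 0) := by
    refine Finset.sum_congr rfl fun a _ => Finset.sum_congr rfl fun b _ => ?_
    rw [hD b a, hmul, congrFun (hD a b) f]
    by_cases h : a = b
    · subst h; simp
    · simp [h]
  rw [hlhs] at hcas
  simp only [Finset.sum_ite_eq, Finset.mem_univ, if_true, Finset.sum_const, Finset.card_univ,
    Fintype.card_fin, nsmul_eq_mul, Fintype.card_prod] at hcas
  push_cast at hcas
  have hk' : (k : ℂ) ≠ 0 := by exact_mod_cast hk.ne'
  have hmain : (2 * k : ℂ) = n * (n - 1) := by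
    have hf' : ψ f ≠ 0 := hf
    field_simp at hcas
    linear_combination hcas
  have hnat : 2 * k = n * (n - 1) := by
    have h1 : ((2 * k : ℕ) : ℂ) = ((n * (n - 1) : ℕ) : ℂ) := by
      rw [Nat.cast_mul n, Nat.cast_sub hn]
      push_cast
      exact hmain
    exact_mod_cast h1
  omega

end Count

/-! ### Components of a wave function -/

section Components

open exteriorPower

variable {n k : ℕ}

/-- The component of a quark state at a pair of gauge indices `p`. -/
noncomputable def quarkComponent (n : ℕ) (p : Fin 2 → Fin n) : Module.Dual ℂ (Quark n) :=
  pairingDual ℂ (Fin n → ℂ) 2 (ιMulti ℂ 2 fun r => (Pi.basisFun ℂ (Fin n)).coord (p r))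

/-- The component of a wave function at an assignment of gauge indices to the `2k` index slots
of its `k` quarks. -/
noncomputable def component (f : Fin k × Fin 2 → Fin n) :
    Module.Dual ℂ (WaveFunction (Quark n) k) :=
  TensorPower.multilinearMapToDual ℂ (Quark n) k fun i => quarkComponent n fun r => f (i, r)

lemma quarkComponent_swap (p : Fin 2 → Fin n) :
    quarkComponent n (p ∘ Equiv.swap 0 1) = -quarkComponent n p := by
  rw [quarkComponent, quarkComponent, ← map_neg, ← AlternatingMap.map_swap (ιMulti ℂ 2) _
    (show (0 : Fin 2) ≠ 1 by decide)]
  rfl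

lemma pairingDual_ιMulti_map {V : Type*} [AddCommGroup V] [Module ℂ V] {m : ℕ} (g : V →ₗ[ℂ] V)
    (ℓ : Fin m → Module.Dual ℂ V) (x : ⋀[ℂ]^m V) :
    pairingDual ℂ V m (ιMulti ℂ m ℓ) (exteriorPower.map m g x) =
      pairingDual ℂ V m (ιMulti ℂ m fun r => ℓ r ∘ₗ g) x := by
  rw [← LinearMap.comp_apply]
  congr 1
  ext v
  simp [pairingDual_ιMulti_ιMulti]

lemma quarkComponent_rep (g : GaugeGroup n) (p : Fin 2 → Fin n) (w : Quark n) :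
    quarkComponent n p (quarkRep n g w) =
      ∑ q : Fin 2 → Fin n, (∏ r, (g : Matrix (Fin n) (Fin n) ℂ) (p r) (q r)) *
        quarkComponent n q w := by
  have h1 : quarkComponent n p (quarkRep n g w) = pairingDual ℂ (Fin n → ℂ) 2
      (ιMulti ℂ 2 fun r => (Pi.basisFun ℂ (Fin n)).coord (p r) ∘ₗ fundamentalRep n g) w :=
    pairingDual_ιMulti_map _ _ w
  have h2 : (fun r => (Pi.basisFun ℂ (Fin n)).coord (p r) ∘ₗ fundamentalRep n g) =
      fun r => ∑ c, (g : Matrix (Fin n) (Fin n) ℂ) (p r) c •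
        (Pi.basisFun ℂ (Fin n)).coord c := by
    ext r v
    simp [fundamentalRep, Pi.single_apply]
  rw [h1, h2]
  have h3 := (ιMulti ℂ 2 (M := Module.Dual ℂ (Fin n → ℂ))).toMultilinearMap.map_sum
    (fun r c => (g : Matrix (Fin n) (Fin n) ℂ) (p r) c • (Pi.basisFun ℂ (Fin n)).coord c)
  have h4 : ∀ q : Fin 2 → Fin n, (ιMulti ℂ 2 (M := Module.Dual ℂ (Fin n → ℂ))).toMultilinearMap
      (fun r => (g : Matrix (Fin n) (Fin n) ℂ) (p r) (q r) •
        (Pi.basisFun ℂ (Fin n)).coord (q r)) =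
      (∏ r, (g : Matrix (Fin n) (Fin n) ℂ) (p r) (q r)) •
        ιMulti ℂ 2 fun r => (Pi.basisFun ℂ (Fin n)).coord (q r) := fun q =>
    MultilinearMap.map_smul_univ _ _ _
  simp only [h4] at h3
  erw [h3]
  simp [quarkComponent]

lemma component_flip (i : Fin k) (f : Fin k × Fin 2 → Fin n) :
    component (f ∘ Equiv.swap (i, 0) (i, 1)) = -component f := by
  have h : (fun j => quarkComponent n fun r => (f ∘ Equiv.swap (i, 0) (i, 1)) (j, r)) =
      Function.update (fun j => quarkComponent n fun r => f (j, r)) i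
        (-quarkComponent n fun r => f (i, r)) := by
    funext j
    rcases eq_or_ne j i with rfl | hj
    · rw [Function.update_self, ← quarkComponent_swap]
      congr 1
      funext r
      fin_cases r <;> simp
    · rw [Function.update_of_ne hj]
      congr 1
      funext r
      rw [Function.comp_apply, Equiv.swap_apply_of_ne_of_ne] <;> simp [hj]
  rw [component, h, MultilinearMap.map_update_neg, Function.update_eq_self, component]

lemma component_exchange (i j : Fin k) (f : Fin k × Fin 2 → Fin n)
    (ψ : WaveFunction (Quark n) k) :
    component f (exchange (Quark n) i j ψ) = component (f ∘ Prod.map (Equiv.swap i j) id) ψ := by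
  rw [← LinearMap.comp_apply]
  congr 1
  ext v
  simp only [LinearMap.compMultilinearMap_apply, LinearMap.comp_apply, exchange,
    LinearEquiv.coe_coe]
  erw [PiTensorProduct.reindex_tprod]
  simp only [component, TensorPower.multilinearMapToDual_apply_tprod]
  rw [← Equiv.prod_comp (Equiv.swap i j)]
  refine Finset.prod_congr rfl fun x _ => ?_
  exact congrArg (fun y => quarkComponent n (fun r => f (Equiv.swap i j x, r)) (v y))
    ((Equiv.swap i j).symm_apply_apply x)

lemma component_rep (g : GaugeGroup n) (f : Fin k × Fin 2 → Fin n)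
    (ψ : WaveFunction (Quark n) k) :
    component f (tensorPowerRep (quarkRep n) k g ψ) =
      tensorAct (g : Matrix (Fin n) (Fin n) ℂ) (fun h => component h ψ) f := by
  have h1 : component f (tensorPowerRep (quarkRep n) k g ψ) =
      TensorPower.multilinearMapToDual ℂ (Quark n) k
        (fun i => quarkComponent n (fun r => f (i, r)) ∘ₗ quarkRep n g) ψ := by
    rw [← LinearMap.comp_apply]
    congr 1
    ext v
    simp [component, tensorPowerRep]
  have h2 : (fun i => quarkComponent n (fun r => f (i, r)) ∘ₗ quarkRep n g) =
      fun i => ∑ q : Fin 2 → Fin n,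
        (∏ r, (g : Matrix (Fin n) (Fin n) ℂ) (f (i, r)) (q r)) • quarkComponent n q := by
    funext i
    refine LinearMap.ext fun w => ?_
    rw [LinearMap.comp_apply, quarkComponent_rep]
    simp
  rw [h1, h2, MultilinearMap.map_sum]
  simp only [MultilinearMap.map_smul_univ, LinearMap.sum_apply, LinearMap.smul_apply,
    smul_eq_mul, tensorAct]
  refine Fintype.sum_equiv (Equiv.curry (Fin k) (Fin 2) (Fin n)).symm _ _ fun q => ?_
  rw [Fintype.prod_prod_type]
  rfl

lemma eq_zero_of_component_eq_zero {ψ : WaveFunction (Quark n) k}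
    (h : ∀ f : Fin k × Fin 2 → Fin n, component f ψ = 0) : ψ = 0 := by
  let B := (Pi.basisFun ℂ (Fin n)).exteriorPower 2
  refine (Basis.piTensorProduct fun _ : Fin k => B).ext_elem fun s => ?_
  rw [map_zero, Finsupp.zero_apply, ← h fun x => Set.powersetCard.ofFinEmbEquiv.symm (s x.1) x.2]
  rw [← Module.Basis.coord_apply]
  congr 1
  ext v
  simp only [LinearMap.compMultilinearMap_apply, Module.Basis.coord_apply,
    Basis.piTensorProduct_repr_tprod_apply, component,
    TensorPower.multilinearMapToDual_apply_tprod]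
  refine Finset.prod_congr rfl fun i _ => ?_
  rw [basis_repr_apply]
  rfl

/-- A nonzero completely antisymmetric gauge singlet of `k > 0` quarks has `n(n-1)/2` quarks. -/
lemma card_quarks_eq (hk : 0 < k) {ψ : WaveFunction (Quark n) k}
    (hψ : ψ ∈ antisymmetricSinglets (quarkRep n) k) (h0 : ψ ≠ 0) : k = n * (n - 1) / 2 := by
  obtain ⟨hs, ha⟩ := hψ
  refine eq_of_invariant_tensor hk (ψ := fun f => component f ψ) ?_ ?_ ?_ ?_
  · intro i f
    rw [component_flip, LinearMap.neg_apply]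
  · intro i j hij f
    rw [← component_exchange, ha i j hij, map_neg]
  · intro g f
    rw [← component_rep, hs g]
  · intro h
    exact h0 (eq_zero_of_component_eq_zero fun f => congrFun h f)

end Components

/-! ### Exterior powers as antisymmetric tensors -/

section Antisymmetrizer

open exteriorPower

variable {V : Type} [AddCommGroup V] [Module ℂ V] {k : ℕ}

/-- The canonical projection of the tensor power onto the exterior power. -/
noncomputable def toExteriorPower (V : Type) [AddCommGroup V] [Module ℂ V] (k : ℕ) :
    WaveFunction V k →ₗ[ℂ] ⋀[ℂ]^k V :=
  PiTensorProduct.lift (ιMulti ℂ k).toMultilinearMap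

lemma toTensorPower_toExteriorPower (ψ : WaveFunction V k) :
    toTensorPower ℂ V k (toExteriorPower V k ψ) =
      ∑ σ : Equiv.Perm (Fin k), Equiv.Perm.sign σ •
        PiTensorProduct.reindex ℂ (fun _ : Fin k => V) σ.symm ψ := by
  induction ψ using PiTensorProduct.induction_on with
  | smul_tprod r v =>
    simp only [toExteriorPower, map_smul, PiTensorProduct.lift.tprod,
      AlternatingMap.coe_multilinearMap, toTensorPower_apply_ιMulti, Finset.smul_sum]
    refine Finset.sum_congr rfl fun σ _ => ?_
    rw [smul_comm]
    congr 2
    erw [PiTensorProduct.reindex_tprod]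
    rfl
  | add x y hx hy =>
    simp only [map_add, hx, hy, Units.smul_def, zsmul_add, Finset.sum_add_distrib]

lemma toExteriorPower_toTensorPower (x : ⋀[ℂ]^k V) :
    toExteriorPower V k (toTensorPower ℂ V k x) = (k.factorial : ℂ) • x := by
  have h : toExteriorPower V k ∘ₗ toTensorPower ℂ V k = (k.factorial : ℂ) • LinearMap.id := by
    ext v : 2
    have hσ : ∀ σ : Equiv.Perm (Fin k),
        Equiv.Perm.sign σ • ιMulti ℂ k (fun i => v (σ i)) = ιMulti ℂ k v := by
      intro σ
      have := (ιMulti ℂ k).map_perm v σ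
      rw [Function.comp_def] at this
      rw [this, smul_smul, Int.units_mul_self, one_smul]
    have hz : ∀ (u : ℤˣ) (y : WaveFunction V k),
        toExteriorPower V k (u • y) = u • toExteriorPower V k y := fun u y => by
      simp only [Units.smul_def, map_zsmul]
    simp only [LinearMap.compAlternatingMap_apply, LinearMap.comp_apply,
      toTensorPower_apply_ιMulti, map_sum, hz]
    simp only [toExteriorPower, PiTensorProduct.lift.tprod,
      AlternatingMap.coe_multilinearMap, hσ]
    simp [Fintype.card_perm, Nat.cast_smul_eq_nsmul]
  exact LinearMap.congr_fun h x

lemma toTensorPower_injective : Function.Injective (toTensorPower ℂ V k) := by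
  intro x y hxy
  have h := congrArg (toExteriorPower V k) hxy
  rw [toExteriorPower_toTensorPower, toExteriorPower_toTensorPower] at h
  exact smul_right_injective _ (Nat.cast_ne_zero.mpr k.factorial_ne_zero) h

lemma reindex_of_mem_antisymmetric {ψ : WaveFunction V k} (hψ : ψ ∈ antisymmetric V k)
    (σ : Equiv.Perm (Fin k)) :
    PiTensorProduct.reindex ℂ (fun _ : Fin k => V) σ ψ = Equiv.Perm.sign σ • ψ := by
  induction σ using Equiv.Perm.swap_induction_on' with
  | one =>
    rw [map_one, one_smul]
    exact LinearEquiv.congr_fun (PiTensorProduct.reindex_refl) ψ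
  | mul_swap σ i j hij ih =>
    have h1 : PiTensorProduct.reindex ℂ (fun _ : Fin k => V) (σ * Equiv.swap i j) ψ =
        PiTensorProduct.reindex ℂ (fun _ : Fin k => V) σ
          (PiTensorProduct.reindex ℂ (fun _ : Fin k => V) (Equiv.swap i j) ψ) :=
      (PiTensorProduct.reindex_reindex _ _ _).symm
    have h2 : PiTensorProduct.reindex ℂ (fun _ : Fin k => V) (Equiv.swap i j) ψ = -ψ :=
      hψ i j hij
    rw [h1, h2, map_neg, ih, Equiv.Perm.sign_mul, Equiv.Perm.sign_swap hij]
    simp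

lemma toTensorPower_mem_antisymmetric (x : ⋀[ℂ]^k V) :
    toTensorPower ℂ V k x ∈ antisymmetric V k := by
  intro i j hij
  have h : exchange V i j ∘ₗ toTensorPower ℂ V k = -toTensorPower ℂ V k := by
    ext v : 2
    have hz : ∀ (u : ℤˣ) (y : WaveFunction V k),
        exchange V i j (u • y) = u • exchange V i j y := fun u y => by
      simp only [Units.smul_def, map_zsmul]
    simp only [LinearMap.compAlternatingMap_apply, LinearMap.comp_apply, LinearMap.neg_apply,
      toTensorPower_apply_ιMulti, map_sum, hz]
    rw [← Finset.sum_neg_distrib]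
    refine Fintype.sum_equiv (Equiv.mulRight (Equiv.swap i j)) _ _ fun σ => ?_
    rw [Equiv.coe_mulRight, Equiv.Perm.sign_mul, Equiv.Perm.sign_swap hij, mul_neg, mul_one,
      Units.neg_smul, neg_neg]
    congr 1
    exact PiTensorProduct.reindex_tprod _ _
  exact LinearMap.congr_fun h x

/-- Antisymmetrization identifies the exterior power with the completely antisymmetric tensors. -/
lemma range_toTensorPower : LinearMap.range (toTensorPower ℂ V k) = antisymmetric V k := by
  refine le_antisymm ?_ fun ψ hψ => ?_
  · rintro _ ⟨x, rfl⟩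
    exact toTensorPower_mem_antisymmetric x
  · refine ⟨(k.factorial : ℂ)⁻¹ • toExteriorPower V k ψ, ?_⟩
    rw [map_smul, toTensorPower_toExteriorPower]
    have : ∀ σ : Equiv.Perm (Fin k), Equiv.Perm.sign σ •
        PiTensorProduct.reindex ℂ (fun _ : Fin k => V) σ.symm ψ = ψ := fun σ => by
      rw [reindex_of_mem_antisymmetric hψ, Equiv.Perm.sign_symm, smul_smul, Int.units_mul_self,
        one_smul]
    rw [Finset.sum_congr rfl fun σ _ => this σ, Finset.sum_const, Finset.card_univ,
      Fintype.card_perm, Fintype.card_fin, ← Nat.cast_smul_eq_nsmul ℂ, smul_smul,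
      inv_mul_cancel₀ (Nat.cast_ne_zero.mpr k.factorial_ne_zero), one_smul]

lemma toTensorPower_rep {G : Type} [Group G] (ρ : Representation ℂ G V) (g : G) (x : ⋀[ℂ]^k V) :
    toTensorPower ℂ V k (exteriorPowerRep ρ k g x) =
      tensorPowerRep ρ k g (toTensorPower ℂ V k x) := by
  have h : toTensorPower ℂ V k ∘ₗ exteriorPowerRep ρ k g =
      tensorPowerRep ρ k g ∘ₗ toTensorPower ℂ V k := by
    ext v : 2
    have hz : ∀ (u : ℤˣ) (y : WaveFunction V k),
        tensorPowerRep ρ k g (u • y) = u • tensorPowerRep ρ k g y := fun u y => by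
      simp only [Units.smul_def, map_zsmul]
    have hv : exteriorPowerRep ρ k g (ιMulti ℂ k v) = ιMulti ℂ k (ρ g ∘ v) :=
      exteriorPower.map_apply_ιMulti _ _
    simp only [LinearMap.compAlternatingMap_apply, LinearMap.comp_apply, hv,
      toTensorPower_apply_ιMulti, map_sum, hz]
    refine Finset.sum_congr rfl fun σ _ => ?_
    congr 1
    exact (PiTensorProduct.map_tprod _ _).symm
  exact LinearMap.congr_fun h x

lemma antisymmetricSinglets_eq_map {G : Type} [Group G] (ρ : Representation ℂ G V) (k : ℕ) :
    antisymmetricSinglets ρ k =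
      (exteriorPowerRep ρ k).invariants.map (toTensorPower ℂ V k) := by
  ext ψ
  constructor
  · rintro ⟨hs, ha⟩
    rw [← range_toTensorPower] at ha
    obtain ⟨x, rfl⟩ := ha
    refine ⟨x, fun g => toTensorPower_injective ?_, rfl⟩
    rw [toTensorPower_rep]
    exact hs g
  · rintro ⟨x, hx, rfl⟩
    refine ⟨fun g => ?_, toTensorPower_mem_antisymmetric x⟩
    rw [← toTensorPower_rep, hx g]

end Antisymmetrizer

/-! ### The top exterior power of `Λ²` -/

section Top

open exteriorPower Matrix

lemma exteriorPower_map_top {W : Type*} [AddCommGroup W] [Module ℂ W] [FiniteDimensional ℂ W]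
    {N : ℕ} (hN : Module.finrank ℂ W = N) (f : W →ₗ[ℂ] W) (x : ⋀[ℂ]^N W) :
    exteriorPower.map N f x = LinearMap.det f • x := by
  let e := Module.finBasisOfFinrankEq ℂ W hN
  have h : exteriorPower.map N f = LinearMap.det f • LinearMap.id := by
    ext v : 2
    simp only [LinearMap.compAlternatingMap_apply, map_apply_ιMulti, LinearMap.smul_apply,
      LinearMap.id_apply]
    rw [← sub_eq_zero, ← Module.forall_dual_apply_eq_zero_iff ℂ]
    intro ℓ
    have hℓ : ∀ w, ℓ (ιMulti ℂ N w) = ℓ (ιMulti ℂ N e) * e.det w := fun w => by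
      have := congrArg (· w) ((ℓ.compAlternatingMap (ιMulti ℂ N)).eq_smul_basis_det e)
      simpa using this
    rw [map_sub, map_smul, hℓ, hℓ v, e.det_comp, smul_eq_mul]
    ring
  exact LinearMap.congr_fun h x

/-- The determinant of the endomorphism of `Λ²(ℂⁿ)` induced by a matrix. -/
noncomputable def detSquare {n : ℕ} (M : Matrix (Fin n) (Fin n) ℂ) : ℂ :=
  LinearMap.det (exteriorPower.map 2 M.mulVecLin)

variable {n : ℕ}

lemma detSquare_mul (A B : Matrix (Fin n) (Fin n) ℂ) :
    detSquare (A * B) = detSquare A * detSquare B := by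
  rw [detSquare, mulVecLin_mul, exteriorPower.map_comp, LinearMap.det_comp]
  rfl

lemma detSquare_one : detSquare (1 : Matrix (Fin n) (Fin n) ℂ) = 1 := by
  rw [detSquare, mulVecLin_one, exteriorPower.map_id, LinearMap.det_id]

lemma detSquare_ne_zero {A : Matrix (Fin n) (Fin n) ℂ} (hA : A.det ≠ 0) : detSquare A ≠ 0 := by
  intro h
  have := detSquare_mul A A⁻¹
  rw [mul_nonsing_inv A (Ne.isUnit hA), detSquare_one, h, zero_mul] at this
  exact one_ne_zero this

/-- Each index lies in `n - 1` of the two-element subsets which label the basis of `Λ²(ℂⁿ)`. -/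
lemma detSquare_diagonal (D : Fin n → ℂ) :
    detSquare (diagonal D) = (diagonal D).det ^ (n - 1) := by
  let B := (Pi.basisFun ℂ (Fin n)).exteriorPower 2
  have hB : ∀ s, exteriorPower.map 2 (diagonal D).mulVecLin (B s) =
      (∏ i ∈ (s : Finset (Fin n)), D i) • B s := by
    intro s
    have h1 : (diagonal D).mulVecLin ∘ Pi.basisFun ℂ (Fin n) =
        fun i => D i • Pi.basisFun ℂ (Fin n) i := by
      ext i j
      simp [mulVec_diagonal, Pi.single_apply]
      grind
    rw [basis_apply, map_apply_ιMulti_family, h1, ιMulti_family, ιMulti_family]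
    have h2 := (ιMulti ℂ 2 (M := Fin n → ℂ)).toMultilinearMap.map_smul_univ
      (fun r => D (Set.powersetCard.ofFinEmbEquiv.symm s r))
      (fun r => Pi.basisFun ℂ (Fin n) (Set.powersetCard.ofFinEmbEquiv.symm s r))
    refine h2.trans ?_
    congr 1
    have hs : (s : Finset (Fin n)) =
        Finset.univ.map (Set.powersetCard.ofFinEmbEquiv.symm s).toEmbedding := by
      ext i
      have := Set.powersetCard.mem_range_ofFinEmbEquiv_symm_iff_mem s i
      rw [Set.powersetCard.mem_coe_iff, ← this]
      simp
    rw [hs, Finset.prod_map]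
    rfl
  have hM : LinearMap.toMatrix B B (exteriorPower.map 2 (diagonal D).mulVecLin) =
      diagonal fun s : Set.powersetCard (Fin n) 2 => ∏ i ∈ (s : Finset (Fin n)), D i := by
    ext s t
    rw [LinearMap.toMatrix_apply, hB, map_smul, B.repr_self, diagonal_apply]
    by_cases h : s = t
    · subst h; simp
    · simp [h]
  rw [detSquare, ← LinearMap.det_toMatrix B, hM, det_diagonal, det_diagonal,
    ← Finset.prod_pow]
  have h3 : ∏ s : Set.powersetCard (Fin n) 2, ∏ i ∈ (s : Finset (Fin n)), D i =
      ∏ s ∈ Finset.powersetCard 2 (Finset.univ : Finset (Fin n)), ∏ i ∈ s, D i := by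
    refine (Finset.prod_subtype _ (fun s => ?_) fun s : Finset (Fin n) => ∏ i ∈ s, D i).symm
    simp [Set.powersetCard.mem_iff]
  rw [h3, Finset.prod_comm' (t' := Finset.univ) (s' := fun i =>
    (Finset.powersetCard 2 (Finset.univ : Finset (Fin n))).filter ({i} ⊆ ·))
    (by simp)]
  refine Finset.prod_congr rfl fun i _ => ?_
  rw [Finset.prod_const]
  congr 1
  rw [Finset.card_filter_powersetCard_subset _ _ _ (Finset.subset_univ _) (by simp)]
  simp

/-- A suitable diagonal matrix conjugates a transvection to its square, so a multiplicative
function which is nonzero on invertible matrices takes the value `1` on it. -/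
lemma detSquare_transvection {i j : Fin n} (hij : i ≠ j) (c : ℂ) :
    detSquare (transvection i j c) = 1 := by
  let D : Matrix (Fin n) (Fin n) ℂ := diagonal (Function.update 1 i 2)
  have hD : D.det ≠ 0 := by
    rw [det_diagonal, Finset.prod_ne_zero_iff]
    intro r _
    by_cases h : r = i
    · subst h; simp
    · simp [h]
  have hconj : D * transvection i j c = transvection i j c * transvection i j c * D := by
    rw [transvection_mul_transvection_same i j hij]
    simp only [transvection, mul_add, add_mul, mul_one, one_mul]
    congr 1
    ext a b
    simp only [D, diagonal_mul, mul_diagonal, single_apply]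
    by_cases ha : i = a <;> by_cases hb : j = b
    · subst ha hb
      simp only [and_self, if_true, Function.update_self, Function.update_of_ne hij.symm,
        Pi.one_apply]
      ring
    · simp [hb]
    · simp [ha]
    · simp [ha]
  have h := congrArg detSquare hconj
  simp only [detSquare_mul] at h
  have ht : detSquare (transvection i j c) ≠ 0 :=
    detSquare_ne_zero (by rw [det_transvection_of_ne i j hij]; exact one_ne_zero)
  have hd := detSquare_ne_zero hD
  apply mul_left_cancel₀ (mul_ne_zero ht hd)
  linear_combination -h

lemma detSquare_eq_one {M : Matrix (Fin n) (Fin n) ℂ} (hM : M.det = 1) : detSquare M = 1 := by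
  refine diagonal_transvection_induction (fun A => detSquare A = 1) M ?_ ?_ ?_
  · intro D hD
    rw [detSquare_diagonal, hD, hM, one_pow]
  · intro t
    exact detSquare_transvection t.hij t.c
  · intro A B hA hB
    rw [detSquare_mul, hA, hB, one_mul]

lemma finrank_quark (n : ℕ) : Module.finrank ℂ (Quark n) = n * (n - 1) / 2 := by
  rw [exteriorPower.finrank_eq, Module.finrank_fin_fun, Nat.choose_two_right]

/-- `SU(n)` acts trivially on the top exterior power of `Λ²(ℂⁿ)`. -/
lemma invariants_top (n : ℕ) :
    (exteriorPowerRep (quarkRep n) (n * (n - 1) / 2)).invariants = ⊤ := by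
  rw [eq_top_iff]
  intro x _ g
  have h : exteriorPowerRep (quarkRep n) (n * (n - 1) / 2) g x =
      LinearMap.det (quarkRep n g) • x := exteriorPower_map_top (finrank_quark n) _ x
  have hdet : LinearMap.det (quarkRep n g) = 1 :=
    detSquare_eq_one (mem_specialUnitaryGroup_iff.mp g.2).2
  rw [h, hdet, one_smul]

lemma finrank_invariants_top (n : ℕ) :
    Module.finrank ℂ (exteriorPowerRep (quarkRep n) (n * (n - 1) / 2)).invariants = 1 := by
  rw [invariants_top, finrank_top, exteriorPower.finrank_eq, finrank_quark, Nat.choose_self]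

end Top

theorem proposition2 (n : ℕ) :
    -- a nonzero antisymmetric singlet of `k > 0` quarks has exactly `n(n-1)/2` quarks
    (∀ k : ℕ, 0 < k → ∀ ψ ∈ antisymmetricSinglets (quarkRep n) k, ψ ≠ 0 →
      k = n * (n - 1) / 2) ∧
    -- for `n(n-1)/2` quarks it exists and is unique up to a scalar factor
    Module.finrank ℂ ↥(antisymmetricSinglets (quarkRep n) (n * (n - 1) / 2)) = 1 ∧
    -- and it spans the whole antisymmetric subspace of the tensor product
    antisymmetricSinglets (quarkRep n) (n * (n - 1) / 2) =
      antisymmetric (Quark n) (n * (n - 1) / 2) ∧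
    -- the same in terms of the exterior powers `Λᵏ(Λ² ℂⁿ)`
    (∀ k : ℕ, 0 < k → (exteriorPowerRep (quarkRep n) k).invariants ≠ ⊥ →
      k = n * (n - 1) / 2) ∧
    Module.finrank ℂ
      ↥(exteriorPowerRep (quarkRep n) (n * (n - 1) / 2)).invariants = 1 := by
  refine ⟨fun k hk ψ hψ h0 => card_quarks_eq hk hψ h0, ?_, ?_, fun k hk hne => ?_,
    finrank_invariants_top n⟩
  · rw [antisymmetricSinglets_eq_map]
    exact (Submodule.equivMapOfInjective (exteriorPower.toTensorPower ℂ (Quark n) _)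
      toTensorPower_injective
      (exteriorPowerRep (quarkRep n) _).invariants).finrank_eq.symm.trans (finrank_invariants_top n)
  · rw [antisymmetricSinglets_eq_map, invariants_top, Submodule.map_top, range_toTensorPower]
  · obtain ⟨x, hx, hx0⟩ := Submodule.exists_mem_ne_zero_of_ne_bot hne
    refine card_quarks_eq hk (ψ := exteriorPower.toTensorPower ℂ (Quark n) k x) ?_ ?_
    · rw [antisymmetricSinglets_eq_map]
      exact Submodule.mem_map_of_mem hx
    · rwa [ne_eq, map_eq_zero_iff _ toTensorPower_injective]
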